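/- Let $X$ be an unbounded proper geodesic metric space that is bicombable and coarsely path-connected (coarsely semistable at infinity). Then $$\text{c-cat}(X)\le \operatorname{asdim}(X).$$ The notions are as follows. Write $\mathbb R_+=[0,\infty)$ and $\mathbb N=\{0,1,2,\dots\}$; products of metric spaces carry the maximum metric and subsets the induced metric. - A map $f:Y\to Z$ of metric spaces is *controlled* if for every $r>0$ there is $S>0$ such that $d(y,y')<r$ implies $d(f(y),f(y'))<S$. It is *coarse* if it is controlled and preimages of bounded sets are bounded. No continuity is required. - Maps $f,g:Y\to Z$ are *coarsely homotopic* if there are a coarse map $p:Y\to\mathbb R_+$ and a coarse map $H:\{(y,t)\in Y\times\mathbb R_+ : t\le p(y)\}\to Z$ with $H(y,0)=f(y)$ and $H(y,p(y))=g(y)$ for all $y\in Y$. - A *bicombing* on $X$ is a controlled map $C:X\times X\times\mathbb N\to X$, $(p,x,n)\mapsto C_p(x,n)$, such that $C_p(x,0)=p=C_p(p,n)$ for all $p,x\in X$, $n\in\mathbb N$, and such that for every $p\in X$ and every bounded $K\subseteq X$ there is $N$ with $C_p(x,n)=x$ for all $n\ge N$ and $x\in K$. $X$ is *bicombable* if it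 has a bicombing. - A *coarse $\mathbb R_+$-basepoint* of $X$ is a coarse map $f:\mathbb R_+\to X$ for which there are a quasi-geodesic ray $\gamma:\mathbb R_+\to X$ (that is, $L^{-1}|s-t|-c\le d(\gamma(s),\gamma(t))\le L|s-t|+c$ for all $s,t$, for some $L\ge1$, $c\ge0$) and a constant $M$ with $d(f(t),\gamma(t))\le M$ for all $t$. $X$ is *coarsely path-connected* if any two coarse $\mathbb R_+$-basepoints of $X$ are coarsely homotopic. - A subset $A\subseteq X$ is *coarsely categorical* if there are coarse maps $j:A\to\mathbb R_+$ and $\alpha:\mathbb R_+\to X$ such that $\alpha\circ j$ is coarsely homotopic to the inclusion $A\hookrightarrow X$. The *coarse LS-category* $\text{c-cat}(X)\in\mathbb N\cup\{\infty\}$ is the least $k$ such that $X$ is a union of $k+1$ coarsely categorical subsets ($\infty$ if there is no such $k$). - The *asymptotic dimension* $\operatorname{asdim}(X)\in\mathbb N\cup\{\infty\}$ is the least $n$ such that for every uniformly bounded open cover $\mathcal V$ of $X$ there is a uniformly bounded open cover $\mathcal U$ of $X$ such that every point of $X$ lies in at most $n+1$ members of $\mathcal U$ and every member of $\mathcal V$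 is contained in a member of $\mathcal U$ ($\infty$ if there is no such $n$). -/

import Mathlib

open scoped NNReal

namespace CoarseLS

universe u v

/-- A map of metric spaces is controlled (bornologous) if it maps pairs of points at bounded
distance to pairs of points at bounded distance, uniformly. -/
def IsControlled {X : Type u} {Y : Type v} [MetricSpace X] [MetricSpace Y] (f : X → Y) : Prop :=
  ∀ r : ℝ, 0 < r → ∃ S : ℝ, 0 < S ∧ ∀ x x' : X, dist x x' < r → dist (f x) (f x') < S

/-- A map of metric spaces is (coarsely) proper if preimages of bounded sets are bounded. -/
def IsCoarselyProper {X : Type u} {Y : Type v} [MetricSpace X] [MetricSpace Y] (f : X → Y) :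
    Prop :=
  ∀ B : Set Y, Bornology.IsBounded B → Bornology.IsBounded (f ⁻¹' B)

/-- A coarse map: controlled and proper; not necessarily continuous. -/
def IsCoarse {X : Type u} {Y : Type v} [MetricSpace X] [MetricSpace Y] (f : X → Y) : Prop :=
  IsControlled f ∧ IsCoarselyProper f

/-- Two maps are close if they are a uniformly bounded distance apart. -/
def AreClose {X : Type u} {Y : Type v} [MetricSpace Y] (f g : X → Y) : Prop :=
  ∃ M : ℝ, ∀ x : X, dist (f x) (g x) ≤ M

/-- The `p`-cylinder `{(x, t) ∈ X × [0, ∞) | t ≤ p x}`, with the metric induced from the product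
(Mathlib's product metric is the maximum metric). -/
abbrev Cylinder {X : Type u} (p : X → ℝ≥0) : Type u :=
  {z : X × ℝ≥0 // z.2 ≤ p z.1}

/-- The inclusion `x ↦ (x, 0)` of the bottom of the cylinder. -/
def Cylinder.bottom {X : Type u} (p : X → ℝ≥0) (x : X) : Cylinder p :=
  ⟨(x, 0), zero_le⟩

/-- The inclusion `x ↦ (x, p x)` of the top of the cylinder. -/
def Cylinder.top {X : Type u} (p : X → ℝ≥0) (x : X) : Cylinder p :=
  ⟨(x, p x), le_rfl⟩

/-- Two maps are coarsely homotopic if they are the bottom and the top of a coarse map defined on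
the `p`-cylinder of some coarse map `p` to `[0, ∞)`. -/
def CoarselyHomotopic {X : Type u} {Y : Type v} [MetricSpace X] [MetricSpace Y] (f g : X → Y) :
    Prop :=
  ∃ p : X → ℝ≥0, IsCoarse p ∧ ∃ H : Cylinder p → Y, IsCoarse H ∧
    (∀ x, H (Cylinder.bottom p x) = f x) ∧ (∀ x, H (Cylinder.top p x) = g x)

/-- A quasi-geodesic ray: a quasi-isometric embedding of `[0, ∞)`. -/
def IsQuasiGeodesicRay {X : Type u} [MetricSpace X] (γ : ℝ≥0 → X) : Prop :=
  ∃ L c : ℝ, 1 ≤ L ∧ 0 ≤ c ∧ ∀ s t : ℝ≥0,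
    L⁻¹ * dist s t - c ≤ dist (γ s) (γ t) ∧ dist (γ s) (γ t) ≤ L * dist s t + c

/-- A coarse base-point: a coarse map from `[0, ∞)` that is close to a quasi-geodesic ray. -/
def IsCoarseBasepoint {X : Type u} [MetricSpace X] (f : ℝ≥0 → X) : Prop :=
  IsCoarse f ∧ ∃ γ : ℝ≥0 → X, IsQuasiGeodesicRay γ ∧ AreClose f γ

/-- Coarse path-connectedness (coarse semistability at infinity): any two coarse base-points are
coarsely homotopic. -/
def CoarselyPathConnected (X : Type u) [MetricSpace X] : Prop :=
  ∀ f g : ℝ≥0 → X, IsCoarseBasepoint f → IsCoarseBasepoint g → CoarselyHomotopic f g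

/-- A subset is coarsely categorical if its inclusion is coarsely homotopic to a composition of
coarse maps through `[0, ∞)`. -/
def CoarselyCategorical {X : Type u} [MetricSpace X] (A : Set X) : Prop :=
  ∃ (α : ℝ≥0 → X) (j : A → ℝ≥0), IsCoarse α ∧ IsCoarse j ∧
    CoarselyHomotopic (fun a : A => (a : X)) (α ∘ j)

/-- `X` is covered by `k + 1` coarsely categorical sets. -/
def CCatLE (X : Type u) [MetricSpace X] (k : ℕ) : Prop :=
  ∃ U : Fin (k + 1) → Set X, (∀ i, CoarselyCategorical (U i)) ∧ (⋃ i, U i) = Set.univ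

/-- The (reduced) coarse LS-category: the least `k` such that `X` is covered by `k + 1` coarsely
categorical sets, and `⊤` if there is none. -/
noncomputable def ccat (X : Type u) [MetricSpace X] : ℕ∞ :=
  ⨅ (k : ℕ) (_ : CCatLE X k), (k : ℕ∞)

/-- A uniformly bounded open cover of `X`. -/
def IsUniformlyBoundedOpenCover {X : Type u} [MetricSpace X] (𝒰 : Set (Set X)) : Prop :=
  (∀ A ∈ 𝒰, IsOpen A) ∧ ⋃₀ 𝒰 = Set.univ ∧
    ∃ K : ℝ, ∀ A ∈ 𝒰, ∀ x ∈ A, ∀ y ∈ A, dist x y ≤ K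

/-- The asymptotic dimension of `X` does not exceed `n`: every uniformly bounded open cover
refines a uniformly bounded open cover of multiplicity at most `n + 1`. -/
def AsdimLE (X : Type u) [MetricSpace X] (n : ℕ) : Prop :=
  ∀ 𝒱 : Set (Set X), IsUniformlyBoundedOpenCover 𝒱 →
    ∃ 𝒰 : Set (Set X), IsUniformlyBoundedOpenCover 𝒰 ∧
      (∀ x : X, {A ∈ 𝒰 | x ∈ A}.encard ≤ (n : ℕ∞) + 1) ∧
      ∀ V ∈ 𝒱, ∃ A ∈ 𝒰, V ⊆ A

/-- The asymptotic dimension: the least `n` such that it does not exceed `n`, and `⊤` if there is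
none. -/
noncomputable def asdim (X : Type u) [MetricSpace X] : ℕ∞ :=
  ⨅ (n : ℕ) (_ : AsdimLE X n), (n : ℕ∞)

/-- A bicombing `C (p, x, n) = C_p(x, n)`: a controlled map that starts at `p` at time `0`,
is constant when `x = p`, and for fixed `p` is eventually equal to `x`, uniformly for `x` in a
bounded set. -/
structure IsBicombing {X : Type u} [MetricSpace X] (C : X × X × ℕ → X) : Prop where
  start : ∀ p x : X, C (p, x, 0) = p
  const : ∀ (p : X) (n : ℕ), C (p, p, n) = p
  eventually_eq : ∀ (p : X) (K : Set X), Bornology.IsBounded K →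
    ∃ N : ℕ, ∀ n : ℕ, N ≤ n → ∀ x ∈ K, C (p, x, n) = x
  controlled : IsControlled C

/-- A metric space is bicombable if it admits a bicombing. -/
def Bicombable (X : Type u) [MetricSpace X] : Prop :=
  ∃ C : X × X × ℕ → X, IsBicombing C

/-- A geodesic metric space: any two points are joined by an isometrically embedded interval. -/
def IsGeodesicSpace (X : Type u) [MetricSpace X] : Prop :=
  ∀ x y : X, ∃ γ : ℝ → X, γ 0 = x ∧ γ (dist x y) = y ∧
    ∀ s ∈ Set.Icc 0 (dist x y), ∀ t ∈ Set.Icc 0 (dist x y), dist (γ s) (γ t) = |s - t|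

end CoarseLS

namespace CoarseLS

universe u v

/-! If the asymptotic dimension is at most `n`, then at each scale `X` is a union of `n + 1` sets,
each splitting into far-apart, uniformly bounded pieces (`AsdimLE.exists_labels`). The scale is made
to grow with the distance to a base point, on annuli so wide that the pieces stay small compared
with that distance (`exists_glued_representative`, `AsdimLE.exists_representatives`). In each
resulting set `A`, two points at distance less than `r` either share a piece or both lie in a ball
depending only on `r`. Each piece receives a representative `b x`.

Such an `A` is coarsely categorical (`coarselyCategorical_of_representatives`): comb `x` back to `b
x`, then follow a path of unit steps from `b x` to a fixed geodesic ray. Paths chosen for different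
representatives need no compatibility. Within one piece the bicombing controls the motion uniformly;
otherwise both points lie in a bounded region, which by properness of `X` meets only finitely many
pieces.

The homotopy is proper if its tracks escape to infinity with `x`. Combing lines do, since the pieces
are relatively small. For the paths, geodesics from the base point to a divergent sequence
subconverge to a ray, and by coarse path-connectedness any such ray is joined to the fixed one
outside every ball (`exists_ray_and_paths`). -/

/-! ### Decomposition into separated pieces at scales growing towards infinity -/

/-- If `X` has asymptotic dimension at most `n`, then at every scale `R` it is covered by `n + 1`
sets, each of which is partitioned (by a labelling) into `R`-disjoint uniformly bounded pieces. -/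
lemma AsdimLE.exists_labels {X : Type u} [MetricSpace X] {n : ℕ} (h : AsdimLE X n) {R : ℝ}
    (hR : 0 < R) :
    ∃ (D : ℝ) (A : Fin (n + 1) → Set X) (l : Fin (n + 1) → X → Set (Set X)),
      0 ≤ D ∧ (∀ x, ∃ i, x ∈ A i) ∧
      (∀ i, ∀ x ∈ A i, ∀ y ∈ A i, dist x y < R → l i x = l i y) ∧
      (∀ i, ∀ x ∈ A i, ∀ y ∈ A i, l i x = l i y → dist x y ≤ D) := by
  -- The radius `(n + 2) * R` leaves room for `n + 2` concentric balls about each point, all inside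
  -- a common member of `𝒰`.
  obtain ⟨𝒰, ⟨-, hcov, K, hK⟩, hmult, href⟩ :=
    h (Set.range fun x : X => Metric.ball x ((n + 2 : ℕ) * R)) (by
      refine ⟨?_, ?_, 2 * ((n + 2 : ℕ) * R), ?_⟩
      · rintro _ ⟨x, rfl⟩
        exact Metric.isOpen_ball
      · refine Set.eq_univ_of_forall fun x => ⟨_, ⟨x, rfl⟩, Metric.mem_ball_self ?_⟩
        positivity
      · rintro _ ⟨x, rfl⟩ y hy z hz
        have hy' := Metric.mem_ball.1 hy
        have hz' := Metric.mem_ball.1 hz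
        linarith [dist_triangle_right y z x])
  -- The label of `x` will be `N i x`, and the `i`-th set consists of the points where enlarging the
  -- ball by `R` loses no member. For `R`-close points `N (i + 1) x ⊆ N i y`, so there the labels
  -- agree.
  set N : ℕ → X → Set (Set X) := fun j x => {U ∈ 𝒰 | Metric.ball x ((j + 1 : ℕ) * R) ⊆ U}
    with hN
  have hN_mem : ∀ j x, ∀ U ∈ N j x, x ∈ U := fun j x U hU =>
    hU.2 (Metric.mem_ball_self (by positivity))
  have hN_anti : ∀ j x, N (j + 1) x ⊆ N j x := fun j x U hU =>
    ⟨hU.1, (Metric.ball_subset_ball (by push_cast; nlinarith)).trans hU.2⟩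
  have hN_close : ∀ j x y, dist x y < R → N (j + 1) x ⊆ N j y := fun j x y hxy U hU =>
    ⟨hU.1, (Metric.ball_subset_ball' (by rw [dist_comm]; push_cast; nlinarith)).trans hU.2⟩
  have hN_ne : ∀ j ≤ n + 1, ∀ x, (N j x).Nonempty := fun j hj x => by
    obtain ⟨U, hU, hxU⟩ := href _ ⟨x, rfl⟩
    refine ⟨U, hU, (Metric.ball_subset_ball ?_).trans hxU⟩
    have : ((j + 1 : ℕ) : ℝ) ≤ (n + 2 : ℕ) := by exact_mod_cast (by omega)
    exact mul_le_mul_of_nonneg_right this hR.le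
  have hN_card : ∀ j x, (N j x).encard ≤ (n : ℕ∞) + 1 := fun j x =>
    (Set.encard_le_encard (t := {U ∈ 𝒰 | x ∈ U}) fun U hU =>
      ⟨hU.1, hN_mem j x U hU⟩).trans (hmult x)
  have hN_fin : ∀ j x, (N j x).Finite := fun j x =>
    Set.finite_of_encard_le_coe (k := n + 1) (by exact_mod_cast hN_card j x)
  refine ⟨max K 0, fun i => {x | N i x = N (i + 1) x}, fun i x => N i x, le_max_right _ _,
    ?_, ?_, ?_⟩
  · intro x
    by_contra! hcon
    -- If every enlargement lost a member, the at most `n + 1` members of `N 0 x` would be used up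
    -- after `n + 1` steps, but `N (n + 1) x` is nonempty.
    have hstep : ∀ j ≤ n + 1, j + (N j x).ncard ≤ n + 1 := by
      intro j
      induction j with
      | zero =>
        intro _
        have := hN_card 0 x
        rw [← (hN_fin 0 x).cast_ncard_eq] at this
        have : (N 0 x).ncard ≤ n + 1 := by exact_mod_cast this
        omega
      | succ j ih =>
        intro hj
        have h1 := ih (by omega)
        have h2 : N (j + 1) x ⊂ N j x :=
          (hN_anti j x).ssubset_of_ne fun he => hcon ⟨j, by omega⟩ he.symm
        have := Set.ncard_lt_ncard h2 (hN_fin j x)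
        omega
    have h1 := hstep (n + 1) le_rfl
    have h2 := (Set.ncard_pos (hN_fin (n + 1) x)).2 (hN_ne _ le_rfl x)
    omega
  · intro i x hx y hy hxy
    refine Set.Subset.antisymm ?_ ?_
    · change N i x ⊆ N i y
      rw [show N i x = N (i + 1) x from hx]
      exact hN_close _ _ _ hxy
    · change N i y ⊆ N i x
      rw [show N i y = N (i + 1) y from hy]
      exact hN_close _ _ _ (by rwa [dist_comm])
  · intro i x _ y _ hxy
    obtain ⟨U, hU⟩ := hN_ne i (by omega) x
    have hU' : U ∈ N i y := by
      have : N i x = N i y := hxy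
      rwa [← this]
    exact (hK U hU.1 x (hN_mem _ _ _ hU) y (hN_mem _ _ _ hU')).trans (le_max_left _ _)

/-- Labellings `l m` of sets `A m` into `R m`-disjoint, `D m`-bounded pieces at growing scales are
glued along a level function `lev`, a piece of level `m` being absorbed by a nearby piece of level
`m + 1`. The pieces are recorded by a map `b` to representatives. -/
lemma exists_glued_representative {X : Type u} {Λ : Type v} [MetricSpace X] [Nonempty X]
    (R D : ℕ → ℝ) (A : ℕ → Set X) (l : ℕ → X → Λ) (lev : X → ℕ)
    (hR : ∀ m, 0 < R m) (hD : ∀ m, 0 ≤ D m) (hRD : ∀ m, 2 * R m + D m ≤ R (m + 1))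
    (hclose : ∀ m, ∀ x ∈ A m, ∀ y ∈ A m, dist x y < R m → l m x = l m y)
    (hdiam : ∀ m, ∀ x ∈ A m, ∀ y ∈ A m, l m x = l m y → dist x y ≤ D m)
    (hlev : ∀ x w, lev x + 2 ≤ lev w → 2 * R (lev x + 1) + D (lev x + 1) ≤ dist x w) :
    ∃ b : X → X,
      (∀ x ∈ A (lev x), ∀ y ∈ A (lev y), dist x y < R (lev x) → dist x y < R (lev y) →
        b x = b y) ∧
      ∀ x ∈ A (lev x), ∃ m, lev x ≤ m ∧ m ≤ lev (b x) + 1 ∧ dist (b x) x ≤ D m + 2 * R m := by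
  classical
  have hRmono : Monotone R := monotone_nat_of_le_succ fun m => by linarith [hRD m, hR m, hD m]
  let Absorb : ℕ → Λ → X → Prop := fun m a y =>
    lev y = m + 1 ∧ y ∈ A (m + 1) ∧ ∃ z ∈ A m, lev z = m ∧ l m z = a ∧ dist z y < R m
  let lab : ℕ → Λ → ℕ × Λ := fun m a =>
    if h : ∃ y, Absorb m a y then (m + 1, l (m + 1) h.choose) else (m, a)
  have lab_of : ∀ m a y, Absorb m a y → lab m a = (m + 1, l (m + 1) y) := by
    intro m a y hy
    have h : ∃ y, Absorb m a y := ⟨y, hy⟩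
    obtain ⟨-, hc2, z, hz, -, hza, hzc⟩ := h.choose_spec
    obtain ⟨-, hy2, z', hz', -, hza', hzy⟩ := hy
    have hzz : dist z z' ≤ D m := hdiam m z hz z' hz' (hza.trans hza'.symm)
    -- The absorbing piece is unique: two candidates lie within `2 * R m + D m` of each other, hence
    -- carry the same label at level `m + 1`.
    have hlt : dist h.choose y < R (m + 1) := by
      have h1 := dist_triangle4 h.choose z z' y
      rw [dist_comm h.choose z] at h1
      linarith [hRD m]
    simp only [lab, dif_pos h]
    rw [hclose _ _ hc2 _ hy2 hlt]
  let labx : X → ℕ × Λ := fun x => lab (lev x) (l (lev x) x)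
  let S : Set X := {x | x ∈ A (lev x)}
  have key_of_lt : ∀ x ∈ S, ∀ y ∈ S, lev x < lev y → dist x y < R (lev x) → labx x = labx y := by
    intro x hx y hy hlt hxy
    have hy1 : lev y = lev x + 1 := by
      by_contra hne
      have := hlev x y (by omega)
      linarith [hR (lev x + 1), hD (lev x + 1), hRmono (Nat.le_succ (lev x))]
    have hx_lab : labx x = (lev x + 1, l (lev x + 1) y) :=
      lab_of _ _ _ ⟨hy1, hy1 ▸ hy, x, hx, rfl, rfl, hxy⟩
    -- Absorption does not chain: if the piece of `y` were itself absorbed, `x` would be too close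
    -- to a point two levels higher.
    have hy_not : ¬ ∃ w, Absorb (lev y) (l (lev y) y) w := by
      rintro ⟨w, hw1, -, z, hz, -, hza, hzw⟩
      have h1 := hlev x w (by omega)
      have h2 := hdiam _ z hz y hy hza
      rw [hy1] at h2 hzw
      have h3 := dist_triangle4 x y z w
      rw [dist_comm y z] at h3
      linarith [hRmono (Nat.le_succ (lev x))]
    have hy_lab : labx y = (lev y, l (lev y) y) := by
      simp only [labx, lab, dif_neg hy_not]
    rw [hx_lab, hy_lab, hy1]
  have key : ∀ x ∈ S, ∀ y ∈ S, dist x y < R (lev x) → dist x y < R (lev y) →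
      labx x = labx y := by
    intro x hx y hy h1 h2
    rcases lt_trichotomy (lev x) (lev y) with h | h | h
    · exact key_of_lt x hx y hy h h1
    · have hy' : y ∈ A (lev x) := h ▸ hy
      have := hclose _ x hx y hy' h1
      simp only [labx]
      rw [← h, this]
    · exact (key_of_lt y hy x hx h (by rwa [dist_comm])).symm
  have near : ∀ x ∈ S, ∃ y ∈ A (labx x).1, l (labx x).1 y = (labx x).2 ∧
      dist x y ≤ R (labx x).1 ∧ lev x ≤ (labx x).1 ∧ (labx x).1 ≤ lev x + 1 := by
    intro x hx
    by_cases h : ∃ y, Absorb (lev x) (l (lev x) x) y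
    · obtain ⟨y, hy⟩ := h
      have hl : labx x = _ := lab_of _ _ _ hy
      rw [hl]
      obtain ⟨-, hy2, z, hz, -, hza, hzy⟩ := hy
      refine ⟨y, hy2, rfl, ?_, Nat.le_succ _, le_rfl⟩
      have h1 := hdiam _ z hz x hx hza
      have h2 := dist_triangle x z y
      rw [dist_comm x z] at h2
      linarith [hRD (lev x), hR (lev x)]
    · have hl : labx x = (lev x, l (lev x) x) := by simp only [labx, lab, dif_neg h]
      rw [hl]
      exact ⟨x, hx, rfl, by simpa using (hR _).le, le_rfl, Nat.le_succ _⟩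
  refine ⟨fun x => Function.invFunOn labx S (labx x), ?_, ?_⟩
  · intro x hx y hy h1 h2
    simp only [key x hx y hy h1 h2]
  · intro x hx
    have hex : ∃ a ∈ S, labx a = labx x := ⟨x, hx, rfl⟩
    have hb := Function.invFunOn_mem hex
    have hbx := Function.invFunOn_eq hex
    set b := Function.invFunOn labx S (labx x)
    obtain ⟨y, hy, hly, hdy, h1, -⟩ := near x hx
    obtain ⟨z, hz, hlz, hdz, -, h2⟩ := near b hb
    rw [hbx] at hz hlz hdz h2
    refine ⟨(labx x).1, h1, h2, ?_⟩
    have h3 := hdiam _ z hz y hy (hlz.trans hly.symm)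
    have h4 := dist_triangle4 b z y x
    rw [dist_comm y x] at h4
    linarith

/-- In a space of asymptotic dimension at most `n` with a bicombing, there are `n + 1` covering
sets, each retracted to representatives `b x` such that points with different representatives
diverge at infinity and the combing lines from `b x` to `x` escape to infinity with `x`. -/
lemma AsdimLE.exists_representatives {X : Type u} [MetricSpace X] {n : ℕ}
    (h : AsdimLE X n) (x₀ : X) {C : X × X × ℕ → X} (hC : IsBicombing C) :
    ∃ (A : Fin (n + 1) → Set X) (b : Fin (n + 1) → X → X), (∀ x, ∃ i, x ∈ A i) ∧
      (∀ i, ∀ x ∈ A i, ∀ y ∈ A i, dist x y < 1 → b i x = b i y) ∧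
      (∀ i, ∀ r : ℝ, ∃ B : ℝ, ∀ x ∈ A i, ∀ y ∈ A i, dist x y < r →
        b i x = b i y ∨ (dist x x₀ ≤ B ∧ dist y x₀ ≤ B)) ∧
      (∀ i, ∀ Q : ℝ, ∃ B : ℝ, ∀ x ∈ A i, ∀ k, dist (C (b i x, x, k)) x₀ ≤ Q →
        dist x x₀ ≤ B) := by
  -- The positivity of `R` is moved inside, with junk data for `R ≤ 0`, so that the chosen data
  -- depend on the number `R` alone.
  have h' : ∀ R : ℝ, ∃ (D : ℝ) (A : Fin (n + 1) → Set X) (l : Fin (n + 1) → X → Set (Set X)),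
      0 < R → 0 ≤ D ∧ (∀ x, ∃ i, x ∈ A i) ∧
      (∀ i, ∀ x ∈ A i, ∀ y ∈ A i, dist x y < R → l i x = l i y) ∧
      (∀ i, ∀ x ∈ A i, ∀ y ∈ A i, l i x = l i y → dist x y ≤ D) := by
    intro R
    by_cases hR : 0 < R
    · obtain ⟨D, A, l, hh⟩ := h.exists_labels hR
      exact ⟨D, A, l, fun _ => hh⟩
    · exact ⟨0, fun _ => ∅, fun _ _ => ∅, fun hR' => absurd hR' hR⟩
  choose D A l hDA using h'
  have hctrl : ∀ r : ℝ, ∃ S : ℝ, 0 < r → 0 < S ∧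
      ∀ z z', dist z z' < r → dist (C z) (C z') < S := by
    intro r
    by_cases hr : 0 < r
    · obtain ⟨S, hS⟩ := hC.controlled r hr
      exact ⟨S, fun _ => hS⟩
    · exact ⟨0, fun hr' => absurd hr' hr⟩
  choose S hS using hctrl
  let R : ℕ → ℝ := fun m => Nat.rec 1 (fun _ r => 2 * r + D r + 1) m
  have hR_succ : ∀ m, R (m + 1) = 2 * R m + D (R m) + 1 := fun _ => rfl
  have hR_ge : ∀ m : ℕ, (m : ℝ) + 1 ≤ R m := by
    intro m
    induction m with
    | zero => simp [R]
    | succ m ih =>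
      have h0 : (0 : ℝ) ≤ m := Nat.cast_nonneg m
      have := (hDA (R m) (by linarith)).1
      rw [hR_succ]
      push_cast
      linarith
  have hR : ∀ m, 0 < R m := fun m => by
    have h0 : (0 : ℝ) ≤ m := Nat.cast_nonneg m
    linarith [hR_ge m]
  have hD : ∀ m, 0 ≤ D (R m) := fun m => (hDA _ (hR m)).1
  have hRmono : Monotone R := monotone_nat_of_le_succ fun m => by
    linarith [hR_succ m, hR m, hD m]
  let E : ℕ → ℝ := fun m => D (R m) + 2 * R m + 1
  have hE : ∀ m, 0 < E m := fun m => by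
    have := hD m
    have := hR m
    simp only [E]
    linarith
  -- Level `m` is the annulus from `ρ m` to `ρ (m + 1)`. The term `2 * R m + D (R m)` separates
  -- levels that differ by two. The term `S (E (m + 2))` bounds how far combing lines in a piece
  -- labelled `m + 2` stray from a representative, which may lie as low as level `m + 1`. The last
  -- summand makes the remaining distance tend to infinity.
  let ρ : ℕ → ℝ := fun m =>
    Nat.rec 0 (fun m r => r + 2 * R m + D (R m) + S (E (m + 2)) + (m + 1)) m
  have hρ_succ : ∀ m : ℕ,
      ρ (m + 1) = ρ m + 2 * R m + D (R m) + S (E (m + 2)) + (m + 1) := fun _ => rfl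
  have hρ_step : ∀ m, ρ m + 2 * R m + D (R m) ≤ ρ (m + 1) := fun m => by
    have h0 : (0 : ℝ) ≤ m := Nat.cast_nonneg m
    linarith [hρ_succ m, (hS _ (hE (m + 2))).1]
  have hρmono : Monotone ρ := monotone_nat_of_le_succ fun m => by
    linarith [hρ_step m, hR m, hD m]
  have hρ_nonneg : ∀ m, 0 ≤ ρ m := fun m => hρmono (Nat.zero_le m)
  have hρ_ge : ∀ m : ℕ, S (E (m + 2)) + (m + 1) ≤ ρ (m + 1) := fun m => by
    linarith [hρ_succ m, hρ_nonneg m, hR m, hD m]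
  have hlt : ∀ x : X, ∃ m, dist x x₀ < ρ (m + 1) := by
    intro x
    obtain ⟨m, hm⟩ := exists_nat_gt (dist x x₀)
    exact ⟨m, by linarith [hρ_ge m, (hS _ (hE (m + 2))).1]⟩
  classical
  let lev : X → ℕ := fun x => Nat.find (hlt x)
  have lev_lt : ∀ x, dist x x₀ < ρ (lev x + 1) := fun x => Nat.find_spec (hlt x)
  have lev_ge : ∀ x, ρ (lev x) ≤ dist x x₀ := by
    intro x
    rcases hk : lev x with _ | k
    · exact dist_nonneg
    · exact not_lt.1 (Nat.find_min (hlt x) (m := k) (by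
        change k < lev x
        omega))
  have hlev : ∀ x w, lev x + 2 ≤ lev w →
      2 * R (lev x + 1) + D (R (lev x + 1)) ≤ dist x w := by
    intro x w hxw
    have h1 := hρmono hxw
    have h2 := hρ_step (lev x + 1)
    have h3 := dist_triangle w x x₀
    rw [dist_comm w x] at h3
    linarith [lev_lt x, lev_ge w]
  have : Nonempty X := ⟨x₀⟩
  have hglue := fun i => exists_glued_representative R (fun m => D (R m)) (fun m => A (R m) i)
    (fun m => l (R m) i) lev hR hD (fun m => by linarith [hR_succ m])
    (fun m => (hDA _ (hR m)).2.2.1 i) (fun m => (hDA _ (hR m)).2.2.2 i) hlev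
  choose b hb₁ hb₂ using hglue
  refine ⟨fun i => {x | x ∈ A (R (lev x)) i}, b, ?_, ?_, ?_, ?_⟩
  · exact fun x => (hDA _ (hR (lev x))).2.1 x
  · intro i x hx y hy hxy
    have h1 : ∀ m, 1 ≤ R m := fun m => hRmono (Nat.zero_le m)
    exact hb₁ i x hx y hy (hxy.trans_le (h1 _)) (hxy.trans_le (h1 _))
  · intro i r
    obtain ⟨m, hm⟩ := exists_nat_gt r
    have hfar : ∀ x, m ≤ lev x → r < R (lev x) := fun x hx => by
      linarith [hRmono hx, hR_ge m]
    have hnear : ∀ x, lev x < m → dist x x₀ < ρ m := fun x hx =>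
      (lev_lt x).trans_le (hρmono hx)
    refine ⟨ρ m + |r|, fun x hx y hy hxy => ?_⟩
    have hr := le_abs_self r
    have hr' := abs_nonneg r
    rcases lt_or_ge (lev x) m with h1 | h1
    · right
      have := hnear x h1
      have h2 := dist_triangle y x x₀
      rw [dist_comm y x] at h2
      constructor <;> linarith
    · rcases lt_or_ge (lev y) m with h2 | h2
      · right
        have := hnear y h2
        have h2 := dist_triangle x y x₀
        constructor <;> linarith
      · left
        exact hb₁ i x hx y hy (hxy.trans (hfar x h1)) (hxy.trans (hfar y h2))
  · intro i Q
    obtain ⟨q, hq⟩ := exists_nat_gt Q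
    refine ⟨ρ (q + 2), fun x hx k hk => ?_⟩
    obtain ⟨m, hm1, hm2, hm3⟩ := hb₂ i x hx
    suffices lev x ≤ q + 1 from
      ((lev_lt x).trans_le (hρmono (Nat.succ_le_succ this))).le
    by_contra! hcon
    obtain ⟨m, rfl⟩ : ∃ m', m = m' + 2 := ⟨m - 2, by omega⟩
    -- The combing line to `x` is compared with the constant line from `b i x` to itself.
    have h1 : dist (C (b i x, x, k)) (b i x) < S (E (m + 2)) := by
      have := (hS _ (hE (m + 2))).2 (b i x, x, k) (b i x, b i x, k) (by
        rw [Prod.dist_eq, Prod.dist_eq]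
        simp only [dist_self, max_lt_iff, hE, true_and, and_true]
        rw [dist_comm]
        simp only [E]
        linarith)
      rwa [hC.const] at this
    have h2 : ρ (m + 1) ≤ dist (b i x) x₀ := 
      (hρmono (show m + 1 ≤ lev (b i x) by omega)).trans (lev_ge _)
    have h3 := dist_triangle_left (b i x) x₀ (C (b i x, x, k))
    have h4 : (q : ℝ) ≤ m := by exact_mod_cast (show q ≤ m by omega)
    linarith [hρ_ge m]

/-! ### Chains avoiding balls, rays and escaping paths -/

/-- `x` and `y` are joined by a chain of unit steps that stays at distance at least `Q` from
`x₀`. -/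
def JoinedOutside {X : Type u} [MetricSpace X] (x₀ : X) (Q : ℝ) : X → X → Prop :=
  Relation.ReflTransGen fun x y => dist x y ≤ 1 ∧ Q ≤ dist x x₀ ∧ Q ≤ dist y x₀

section JoinedOutside

variable {X : Type u} [MetricSpace X] {x₀ : X} {Q : ℝ}

lemma JoinedOutside.mono {Q' : ℝ} (hQ : Q ≤ Q') {x y : X} (h : JoinedOutside x₀ Q' x y) :
    JoinedOutside x₀ Q x y := by
  induction h with
  | refl => exact .refl
  | tail _ h ih => exact .tail ih ⟨h.1, hQ.trans h.2.1, hQ.trans h.2.2⟩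

lemma JoinedOutside.symm {x y : X} (h : JoinedOutside x₀ Q x y) : JoinedOutside x₀ Q y x := by
  induction h with
  | refl => exact .refl
  | tail _ h ih => exact .head ⟨by rw [dist_comm]; exact h.1, h.2.2, h.2.1⟩ ih

lemma JoinedOutside.trans {x y z : X} (h : JoinedOutside x₀ Q x y)
    (h' : JoinedOutside x₀ Q y z) : JoinedOutside x₀ Q x z :=
  Relation.ReflTransGen.trans h h'

lemma JoinedOutside.single {x y : X} (h : dist x y ≤ 1) (hx : Q ≤ dist x x₀)
    (hy : Q ≤ dist y x₀) : JoinedOutside x₀ Q x y :=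
  Relation.ReflTransGen.single ⟨h, hx, hy⟩

/-- The chain is frozen at its end so as to be defined at all times. The bound at `x` matters for
the empty chain, which carries no information about its point. -/
lemma JoinedOutside.exists_path {x y : X} (h : JoinedOutside x₀ Q x y) (hx : Q ≤ dist x x₀) :
    ∃ (g : ℕ → X) (M : ℕ), g 0 = x ∧ (∀ n, M ≤ n → g n = y) ∧
      (∀ n, dist (g n) (g (n + 1)) ≤ 1) ∧ ∀ n, Q ≤ dist (g n) x₀ := by
  induction h using Relation.ReflTransGen.head_induction_on with
  | refl => exact ⟨fun _ => y, 0, rfl, fun _ _ => rfl, fun _ => by simp, fun _ => hx⟩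
  | @head a c h _ ih =>
    obtain ⟨g, M, h0, hM, hstep, hQ⟩ := ih h.2.2
    refine ⟨fun n => Nat.casesOn n a g, M + 1, rfl, ?_, ?_, ?_⟩
    · rintro (_ | n) hn
      · omega
      · exact hM n (by omega)
    · rintro (_ | n)
      · change dist a (g 0) ≤ 1
        rw [h0]
        exact h.1
      · exact hstep n
    · rintro (_ | n)
      · exact hx
      · exact hQ n

lemma joinedOutside_of_lipschitz_path {f : ℝ → X} {a b : ℝ} (hab : a ≤ b)
    (hf : ∀ s ∈ Set.Icc a b, ∀ t ∈ Set.Icc a b, dist (f s) (f t) ≤ |s - t|)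
    (hQ : ∀ s ∈ Set.Icc a b, Q ≤ dist (f s) x₀) : JoinedOutside x₀ Q (f a) (f b) := by
  have key : ∀ n : ℕ, JoinedOutside x₀ Q (f a) (f (min (a + n) b)) := by
    intro n
    induction n with
    | zero =>
      simp only [Nat.cast_zero, add_zero, min_eq_left hab]
      exact .refl
    | succ n ih =>
      have hn : (0 : ℝ) ≤ n := Nat.cast_nonneg n
      have h1 : min (a + n) b ∈ Set.Icc a b := ⟨le_min (by linarith) hab, min_le_right _ _⟩
      have h2 : min (a + (n + 1 : ℕ)) b ∈ Set.Icc a b :=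
        ⟨le_min (by push_cast; linarith) hab, min_le_right _ _⟩
      refine ih.trans (.single ((hf _ h1 _ h2).trans ?_) (hQ _ h1) (hQ _ h2))
      refine (abs_min_sub_min_le_max _ _ _ _).trans ?_
      push_cast
      simp
  obtain ⟨n, hn⟩ := exists_nat_ge (b - a)
  have := key n
  rwa [min_eq_right (by linarith)] at this

/-- A geodesic of length at most `K` cannot approach `x₀` by more than `K`. -/
lemma joinedOutside_of_dist_le (hgeo : IsGeodesicSpace X) {K : ℝ} {x y : X}
    (hxy : dist x y ≤ K) (hx : Q + K ≤ dist x x₀) : JoinedOutside x₀ Q x y := by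
  obtain ⟨γ, h0, h1, hγ⟩ := hgeo x y
  have hd : (0 : ℝ) ∈ Set.Icc 0 (dist x y) := ⟨le_rfl, dist_nonneg⟩
  have := joinedOutside_of_lipschitz_path (x₀ := x₀) (Q := Q) (f := γ)
    (dist_nonneg (x := x) (y := y)) (fun s hs t ht => (hγ s hs t ht).le) (fun s hs => by
      have h2 := hγ 0 hd s hs
      rw [h0, zero_sub, abs_neg, abs_of_nonneg hs.1] at h2
      have h3 := dist_triangle x (γ s) x₀
      linarith [hs.2])
  rwa [h0, h1] at this

end JoinedOutside

/-- Coarsely homotopic rays are eventually joined outside any given ball. -/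
lemma CoarselyHomotopic.eventually_joinedOutside {X : Type u} [MetricSpace X]
    (hgeo : IsGeodesicSpace X) (x₀ : X) {f g : ℝ≥0 → X} (h : CoarselyHomotopic f g) (Q : ℝ) :
    ∃ s₀ : ℝ≥0, ∀ s, s₀ ≤ s → JoinedOutside x₀ Q (f s) (g s) := by
  obtain ⟨p, -, H, ⟨hHc, hHp⟩, hf, hg⟩ := h
  obtain ⟨S, -, hS⟩ := hHc 2 two_pos
  obtain ⟨r, hr⟩ := (Metric.isBounded_iff_subset_closedBall (Cylinder.bottom p 0)).1
    (hHp (Metric.closedBall x₀ (Q + S)) Metric.isBounded_closedBall)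
  refine ⟨r.toNNReal + 1, fun s hs => ?_⟩
  -- By properness of `H`, the whole fibre over a large `s` is mapped far out. Unit steps along the
  -- fibre then have images less than `S` apart, which geodesics join outside the ball of radius
  -- `Q`.
  have hfar : ∀ z : Cylinder p, z.1.1 = s → Q + S ≤ dist (H z) x₀ := by
    intro z hz
    by_contra! hlt
    have h1 : dist z (Cylinder.bottom p 0) ≤ r := hr (Metric.mem_closedBall.2 hlt.le)
    have h2 : dist z.1.1 0 ≤ r := (le_max_left _ _).trans h1
    rw [hz, NNReal.dist_eq, NNReal.coe_zero, sub_zero, abs_of_nonneg (NNReal.coe_nonneg s)] at h2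
    have h3 : ((r.toNNReal + 1 : ℝ≥0) : ℝ) ≤ s := hs
    push_cast at h3
    linarith [Real.le_coe_toNNReal r]
  have key : ∀ n : ℕ, JoinedOutside x₀ Q (f s) (H ⟨(s, min n (p s)), min_le_right _ _⟩) := by
    intro n
    induction n with
    | zero =>
      have : (⟨(s, min (0 : ℕ) (p s)), min_le_right _ _⟩ : Cylinder p) = Cylinder.bottom p s := by
        simp [Cylinder.bottom]
      rw [this, hf]
      exact .refl
    | succ n ih =>
      refine ih.trans (joinedOutside_of_dist_le hgeo (hS _ _ ?_).le (hfar _ rfl))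
      rw [Subtype.dist_eq, Prod.dist_eq]
      refine max_lt (by simp) ?_
      rw [NNReal.dist_eq]
      push_cast
      refine (abs_min_sub_min_le_max _ _ _ _).trans_lt ?_
      simp
  obtain ⟨n, hn⟩ := exists_nat_ge (p s)
  have h1 := key n
  have : (⟨(s, min (n : ℝ≥0) (p s)), min_le_right _ _⟩ : Cylinder p) = Cylinder.top p s := by
    simp [Cylinder.top, min_eq_right hn]
  rwa [this, hg] at h1

lemma isCoarseBasepoint_of_isometry {X : Type u} [MetricSpace X] {c : ℝ≥0 → X}
    (hc : Isometry c) : IsCoarseBasepoint c := by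
  refine ⟨⟨fun r hr => ⟨r, hr, fun x y h => by rwa [hc.dist_eq]⟩, fun B hB => ?_⟩,
    c, ⟨1, 0, le_rfl, le_rfl, fun s t => by simp [hc.dist_eq]⟩, 0, fun x => by simp⟩
  exact hc.antilipschitz.isBounded_preimage hB

/-- Geodesics from `x₀` to a sequence tending to infinity subconverge to a geodesic ray, which is
joined to members of the sequence far away from `x₀`. -/
lemma exists_ray_of_sequence {X : Type u} [MetricSpace X] [ProperSpace X]
    (hgeo : IsGeodesicSpace X) (x₀ : X) (a : ℕ → X) (ha : ∀ k : ℕ, (k : ℝ) ≤ dist (a k) x₀) :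
    ∃ c : ℝ≥0 → X, Isometry c ∧ ∀ s : ℝ≥0, ∃ k, JoinedOutside x₀ (s - 1) (a k) (c s) := by
  choose γ h0 h1 hγ using fun k => hgeo x₀ (a k)
  have hmem : ∀ (s : ℝ≥0) (k : ℕ), (s : ℝ) ≤ k → (s : ℝ) ∈ Set.Icc 0 (dist x₀ (a k)) :=
    fun s k hs => ⟨s.2, by rw [dist_comm]; exact hs.trans (ha k)⟩
  have hnorm : ∀ (k : ℕ), ∀ s ∈ Set.Icc 0 (dist x₀ (a k)), dist (γ k s) x₀ = s := by
    intro k s hs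
    have := hγ k s hs 0 ⟨le_rfl, dist_nonneg⟩
    rwa [h0, sub_zero, abs_of_nonneg hs.1] at this
  -- Limits along a single nonprincipal ultrafilter replace the diagonal extraction of a
  -- subsequence.
  let U : Ultrafilter ℕ := Filter.hyperfilter ℕ
  have hU : ∀ s : ℝ≥0, ∀ᶠ k : ℕ in (U : Filter ℕ), (s : ℝ) ≤ k := by
    intro s
    have : (U : Filter ℕ) ≤ Filter.atTop := by
      rw [← Nat.cofinite_eq_atTop]
      exact Filter.hyperfilter_le_cofinite
    exact this (tendsto_natCast_atTop_atTop.eventually_ge_atTop (s : ℝ))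
  have hlim : ∀ s : ℝ≥0, ∃ y, Filter.Tendsto (fun k => γ k s) U (nhds y) := by
    intro s
    obtain ⟨y, -, hy⟩ := (isCompact_closedBall x₀ (s : ℝ)).ultrafilter_le_nhds
      (U.map fun k => γ k s) (by
        rw [Filter.le_principal_iff, Ultrafilter.mem_coe, Ultrafilter.mem_map,
          ← Ultrafilter.mem_coe]
        filter_upwards [hU s] with k hk
        exact Metric.mem_closedBall.2 (hnorm k s (hmem s k hk)).le)
    exact ⟨y, hy⟩
  choose c hc using hlim
  refine ⟨c, Isometry.of_dist_eq fun s t => ?_, fun s => ?_⟩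
  · refine tendsto_nhds_unique ((hc s).dist (hc t)) ?_
    refine Filter.Tendsto.congr' ?_ tendsto_const_nhds
    filter_upwards [hU s, hU t] with k hs ht
    rw [hγ k s (hmem s k hs) t (hmem t k ht), NNReal.dist_eq]
  · obtain ⟨k, hk, hd⟩ := ((hU s).and (Metric.tendsto_nhds.1 (hc s) 1 one_pos)).exists
    have hs := hmem s k hk
    refine ⟨k, ?_⟩
    have h2 : JoinedOutside x₀ (s - 1) (γ k s) (γ k (dist x₀ (a k))) :=
      joinedOutside_of_lipschitz_path hs.2
        (fun u hu t ht => (hγ k u ⟨hs.1.trans hu.1, hu.2⟩ t ⟨hs.1.trans ht.1, ht.2⟩).le)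
        (fun u hu => by
          rw [hnorm k u ⟨hs.1.trans hu.1, hu.2⟩]
          linarith [hu.1])
    rw [h1] at h2
    refine h2.symm.trans (.single hd.le ?_ ?_)
    · rw [hnorm k s hs]
      linarith
    · have h3 := dist_triangle (γ k s) (c s) x₀
      rw [hnorm k s hs] at h3
      linarith

/-- In an unbounded proper geodesic coarsely path-connected space there is a coarse ray to which
every point `b` is joined by a path of unit steps `g b` escaping to infinity with `b`. -/
lemma exists_ray_and_paths {X : Type u} [MetricSpace X] [ProperSpace X]
    (hgeo : IsGeodesicSpace X) (hunb : ¬ Bornology.IsBounded (Set.univ : Set X))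
    (hconn : CoarselyPathConnected X) (x₀ : X) :
    ∃ (α : ℝ≥0 → X) (g : X → ℕ → X) (M : X → ℕ) (j : X → ℝ≥0), IsCoarse α ∧
      (∀ b, g b 0 = b) ∧ (∀ b n, M b ≤ n → g b n = α (j b)) ∧
      (∀ b n, dist (g b n) (g b (n + 1)) ≤ 1) ∧
      ∀ Q : ℝ, ∃ B : ℝ, ∀ b n, dist (g b n) x₀ ≤ Q → dist b x₀ ≤ B := by
  have hseq : ∀ k : ℕ, ∃ x, (k : ℝ) ≤ dist x x₀ := by
    intro k
    by_contra! hcon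
    exact hunb (Metric.isBounded_closedBall.subset fun x _ => Metric.mem_closedBall.2 (hcon x).le)
  choose a ha using hseq
  obtain ⟨α, hα, -⟩ := exists_ray_of_sequence hgeo x₀ a ha
  have hα' := isCoarseBasepoint_of_isometry hα
  -- Otherwise a divergent sequence of unjoined points yields a ray `c` joined to some of them; the
  -- coarse homotopy from `c` to `α` then joins such a point to `α`.
  have hjoin : ∀ Q : ℝ, ∃ B : ℝ, ∀ b, B ≤ dist b x₀ → ∃ s, JoinedOutside x₀ Q b (α s) := by
    intro Q
    by_contra! hcon
    choose a' ha' hna using fun k : ℕ => hcon k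
    obtain ⟨c, hc, hac⟩ := exists_ray_of_sequence hgeo x₀ a' ha'
    obtain ⟨s₀, hs₀⟩ := (hconn c α (isCoarseBasepoint_of_isometry hc)
      hα').eventually_joinedOutside hgeo x₀ Q
    obtain ⟨k, hk⟩ := hac (max s₀ (Q + 1).toNNReal)
    refine hna k _ ((hk.mono ?_).trans (hs₀ _ (le_max_left _ _)))
    have h1 : (((Q + 1).toNNReal : ℝ≥0) : ℝ) ≤ (max s₀ (Q + 1).toNNReal : ℝ≥0) :=
      NNReal.coe_le_coe.2 (le_max_right _ _)
    linarith [Real.le_coe_toNNReal (Q + 1)]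
  classical
  -- The path from `b` is chosen to avoid the largest possible ball of integer radius, so that one
  -- choice serves every `Q`. Radius `0` is always available.
  let r : X → ℕ := fun b =>
    Nat.findGreatest (fun k : ℕ => ∃ s, JoinedOutside x₀ k b (α s)) ⌊dist b x₀⌋₊
  have hr : ∀ b, ∃ s, JoinedOutside x₀ (r b) b (α s) := fun b => by
    refine Nat.findGreatest_spec (P := fun k : ℕ => ∃ s, JoinedOutside x₀ k b (α s))
      (Nat.zero_le _) ⟨0, ?_⟩
    obtain ⟨γ, h0, h1, hγ⟩ := hgeo b (α 0)
    have := joinedOutside_of_lipschitz_path (x₀ := x₀) (Q := ((0 : ℕ) : ℝ)) (f := γ)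
      (dist_nonneg (x := b) (y := α 0)) (fun s hs t ht => (hγ s hs t ht).le)
      (fun s _ => by simp)
    rwa [h0, h1] at this
  have hr_le : ∀ b, (r b : ℝ) ≤ dist b x₀ := fun b =>
    (Nat.le_floor_iff dist_nonneg).1 (Nat.findGreatest_le _)
  choose j hj using hr
  choose g M hg0 hgM hstep hgQ using fun b => (hj b).exists_path (hr_le b)
  refine ⟨α, g, M, j, hα'.1, hg0, hgM, hstep, fun Q => ?_⟩
  obtain ⟨q, hq⟩ := exists_nat_gt Q
  obtain ⟨B, hB⟩ := hjoin q
  refine ⟨max B q, fun b n hn => ?_⟩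
  by_contra! hlt
  obtain ⟨hb1, hb2⟩ := max_lt_iff.1 hlt
  have h1 : q ≤ r b := Nat.le_findGreatest (Nat.le_floor hb2.le) (hB b hb1.le)
  have h2 : (q : ℝ) ≤ r b := by exact_mod_cast h1
  linarith [hgQ b n]

/-! ### Contracting one covering set to a ray -/

lemma isCoarselyProper_of_dist_le {Y : Type u} {Z : Type v} [MetricSpace Y] [MetricSpace Z]
    {f : Y → Z} (z₀ : Z)
    (h : ∀ Q : ℝ, ∃ B : ℝ, ∀ y y', dist (f y) z₀ ≤ Q → dist (f y') z₀ ≤ Q → dist y y' ≤ B) :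
    IsCoarselyProper f := by
  intro s hs
  obtain ⟨Q, hQ⟩ := (Metric.isBounded_iff_subset_closedBall z₀).1 hs
  obtain ⟨B, hB⟩ := h Q
  exact Metric.isBounded_iff.2 ⟨B, fun y hy y' hy' => hB y y' (hQ hy) (hQ hy')⟩

lemma isControlled_of_dist_le {Y : Type u} {Z : Type v} [MetricSpace Y] [MetricSpace Z]
    {f : Y → Z} (h : ∀ r : ℝ, ∃ S : ℝ, ∀ y y', dist y y' < r → dist (f y) (f y') ≤ S) :
    IsControlled f := by
  intro r _
  obtain ⟨S, hS⟩ := h r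
  exact ⟨|S| + 1, by positivity, fun y y' hy => by linarith [hS y y' hy, le_abs_self S]⟩

lemma dist_le_abs_sub_of_step {X : Type u} [MetricSpace X] {g : ℕ → X}
    (hg : ∀ n, dist (g n) (g (n + 1)) ≤ 1) (m n : ℕ) : dist (g m) (g n) ≤ |(m : ℝ) - n| := by
  have key : ∀ m k, dist (g m) (g (m + k)) ≤ k := by
    intro m k
    induction k with
    | zero => simp
    | succ k ih =>
      have := dist_triangle (g m) (g (m + k)) (g (m + (k + 1)))
      have h : dist (g (m + k)) (g (m + (k + 1))) ≤ 1 := hg (m + k)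
      push_cast
      linarith
  rcases le_total m n with h | h
  · obtain ⟨k, rfl⟩ := Nat.exists_eq_add_of_le h
    simpa using key m k
  · obtain ⟨k, rfl⟩ := Nat.exists_eq_add_of_le h
    rw [dist_comm]
    simpa using key n k

/-- A locally constant map (at scale `1`) on a subset of a proper space takes only finitely many
values on bounded sets. -/
lemma exists_bound_comp_of_locally_constant {X : Type u} [MetricSpace X] [ProperSpace X]
    (x₀ : X) {A : Set X} {b : X → X} (h : ∀ x ∈ A, ∀ y ∈ A, dist x y < 1 → b x = b y)
    (w : X → ℝ) (B : ℝ) : ∃ P : ℝ, ∀ x ∈ A, dist x x₀ ≤ B → w (b x) ≤ P := by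
  obtain ⟨t, ht, hcov⟩ := Metric.totallyBounded_iff.1
    (isCompact_closedBall x₀ B).totallyBounded (1 / 2) (by norm_num)
  classical
  let v : X → ℝ := fun y => if h : ∃ x ∈ A, dist x y < 1 / 2 then w (b h.choose) else 0
  obtain ⟨P, hP⟩ := (ht.image v).bddAbove
  refine ⟨P, fun x hx hxB => ?_⟩
  obtain ⟨y, hy, hxy⟩ := Set.mem_iUnion₂.1 (hcov (Metric.mem_closedBall.2 hxB))
  have hex : ∃ x ∈ A, dist x y < 1 / 2 := ⟨x, hx, hxy⟩
  have hv : v y = w (b x) := by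
    simp only [v, dif_pos hex]
    obtain ⟨h1, h2⟩ := hex.choose_spec
    rw [h _ h1 x hx]
    have := dist_triangle_right hex.choose x y
    linarith [Metric.mem_ball.1 hxy]
  rw [← hv]
  exact hP ⟨y, hy, rfl⟩

/-- A set with a retraction to representatives as in `AsdimLE.exists_representatives` is coarsely
categorical: comb each piece to its representative, then follow paths to a ray. -/
lemma coarselyCategorical_of_representatives {X : Type u} [MetricSpace X] [ProperSpace X]
    (hgeo : IsGeodesicSpace X) (hunb : ¬ Bornology.IsBounded (Set.univ : Set X))
    (hconn : CoarselyPathConnected X) (x₀ : X) {C : X × X × ℕ → X} (hC : IsBicombing C)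
    {A : Set X} {b : X → X} (hloc : ∀ x ∈ A, ∀ y ∈ A, dist x y < 1 → b x = b y)
    (hfar : ∀ r : ℝ, ∃ B : ℝ, ∀ x ∈ A, ∀ y ∈ A, dist x y < r →
      b x = b y ∨ (dist x x₀ ≤ B ∧ dist y x₀ ≤ B))
    (hesc : ∀ Q : ℝ, ∃ B : ℝ, ∀ x ∈ A, ∀ k, dist (C (b x, x, k)) x₀ ≤ Q → dist x x₀ ≤ B) :
    CoarselyCategorical A := by
  obtain ⟨α, g, M, j, hα, hg0, hgM, hgs, hgQ⟩ := exists_ray_and_paths hgeo hunb hconn x₀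
  have hbound := exists_bound_comp_of_locally_constant x₀ hloc
  have hb_esc : ∀ Q : ℝ, ∃ B : ℝ, ∀ x ∈ A, dist (b x) x₀ ≤ Q → dist x x₀ ≤ B := fun Q => by
    obtain ⟨B, hB⟩ := hesc Q
    exact ⟨B, fun x hx hQ => hB x hx 0 (by rwa [hC.start])⟩
  -- The points of `A` with representative `β` form a bounded set, so one combing time suffices for
  -- all of them.
  have hN : ∀ β, ∃ N : ℕ, ∀ x ∈ A, b x = β → ∀ n, N ≤ n → C (β, x, n) = x := by
    intro β
    obtain ⟨B, hB⟩ := hb_esc (dist β x₀)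
    obtain ⟨N, hN⟩ := hC.eventually_eq β (Metric.closedBall x₀ B) Metric.isBounded_closedBall
    exact ⟨N, fun x hx hβ n hn => hN n hn x (Metric.mem_closedBall.2 (hB x hx (by rw [hβ])))⟩
  choose N hN using hN
  have hcoarse : ∀ w : X → ℝ≥0,
      (∀ Q : ℝ, ∃ B : ℝ, ∀ x ∈ A, w (b x) ≤ Q → dist x x₀ ≤ B) →
      IsCoarse fun x : A => w (b x) := by
    intro w hw
    constructor
    · refine isControlled_of_dist_le fun r => ?_
      obtain ⟨B, hB⟩ := hfar r
      obtain ⟨P, hP⟩ := hbound (fun β => w β) B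
      refine ⟨|P| + |P|, fun x y hxy => ?_⟩
      rcases hB x x.2 y y.2 hxy with h | ⟨h1, h2⟩
      · rw [h, dist_self]
        positivity
      · have h3 := hP x x.2 h1
        have h4 := hP y y.2 h2
        rw [NNReal.dist_eq, abs_le]
        constructor <;> linarith [le_abs_self P, abs_nonneg P, (w (b x)).2, (w (b y)).2]
    · refine isCoarselyProper_of_dist_le 0 fun Q => ?_
      obtain ⟨B, hB⟩ := hw Q
      refine ⟨B + B, fun x y hx hy => ?_⟩
      rw [NNReal.dist_eq, NNReal.coe_zero, sub_zero, abs_of_nonneg (NNReal.coe_nonneg _)] at hx hy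
      rw [Subtype.dist_eq]
      linarith [dist_triangle_right (x : X) y x₀, hB x x.2 hx, hB y y.2 hy]
  -- The duration covers the combing and the path. The term `⌈dist β x₀⌉₊` makes it proper, and the
  -- final `1` puts the endpoint strictly past the combing phase.
  let P : X → ℕ := fun β => N β + M β + ⌈dist β x₀⌉₊ + 1
  let G : X → X → ℕ → X := fun β x n => if n ≤ N β then C (β, x, N β - n) else g β (n - N β)
  -- Truncated subtraction freezes the inactive phase at `β`, so a comparison across the two phases
  -- is a triangle inequality through `β`.
  have hGdist : ∀ β x x' n n', dist (G β x n) (G β x' n') ≤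
      dist (C (β, x, N β - n)) (C (β, x', N β - n')) + dist (g β (n - N β)) (g β (n' - N β)) := by
    have hlt : ∀ β x n, n ≤ N β → G β x n = C (β, x, N β - n) := fun β x n h => by
      simp only [G, if_pos h]
    have hgt : ∀ β x n, ¬ n ≤ N β → G β x n = g β (n - N β) := fun β x n h => by
      simp only [G, if_neg h]
    have hCz : ∀ β x n, ¬ n ≤ N β → C (β, x, N β - n) = β := fun β x n h => by
      rw [Nat.sub_eq_zero_of_le (by omega), hC.start]
    have hgz : ∀ β n, n ≤ N β → g β (n - N β) = β := fun β n h => by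
      rw [Nat.sub_eq_zero_of_le h, hg0]
    intro β x x' n n'
    by_cases h : n ≤ N β <;> by_cases h' : n' ≤ N β
    · rw [hlt _ _ _ h, hlt _ _ _ h']
      linarith [dist_nonneg (x := g β (n - N β)) (y := g β (n' - N β))]
    · rw [hlt _ _ _ h, hgt _ _ _ h', hCz _ _ _ h', hgz _ _ h]
      exact dist_triangle _ _ _
    · rw [hgt _ _ _ h, hlt _ _ _ h', hCz _ _ _ h, hgz _ _ h', add_comm]
      exact dist_triangle _ _ _
    · rw [hgt _ _ _ h, hgt _ _ _ h']
      linarith [dist_nonneg (x := C (β, x, N β - n)) (y := C (β, x', N β - n'))]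
  have hGesc : ∀ Q : ℝ, ∃ B : ℝ, ∀ x ∈ A, ∀ n, dist (G (b x) x n) x₀ ≤ Q → dist x x₀ ≤ B := by
    intro Q
    obtain ⟨B₁, hB₁⟩ := hesc Q
    obtain ⟨B₂, hB₂⟩ := hgQ Q
    obtain ⟨B₃, hB₃⟩ := hb_esc B₂
    refine ⟨max B₁ B₃, fun x hx n hn => ?_⟩
    simp only [G] at hn
    split_ifs at hn
    · exact (hB₁ x hx _ hn).trans (le_max_left _ _)
    · exact (hB₃ x hx (hB₂ _ _ hn)).trans (le_max_right _ _)
  -- Over a bounded set the representatives and path lengths are bounded, and combing lines stay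
  -- close to the constant lines at their representatives.
  have hGbound : ∀ B : ℝ, ∃ T : ℝ, ∀ x ∈ A, dist x x₀ ≤ B → ∀ n, dist (G (b x) x n) x₀ ≤ T := by
    intro B
    obtain ⟨P₁, hP₁⟩ := hbound (fun β => dist β x₀) B
    obtain ⟨P₂, hP₂⟩ := hbound (fun β => M β) B
    obtain ⟨S, hS0, hS⟩ := hC.controlled (|P₁| + |B| + 1) (by positivity)
    refine ⟨S + |P₂| + |P₁|, fun x hx hxB n => ?_⟩
    have h1 := hP₁ x hx hxB
    have h2 := hP₂ x hx hxB
    have hp₁ := le_abs_self P₁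
    have hp₂ := le_abs_self P₂
    have hb := le_abs_self B
    simp only [G]
    split_ifs
    · have h3 := hS (b x, x, N (b x) - n) (b x, b x, N (b x) - n) (by
        rw [Prod.dist_eq, Prod.dist_eq]
        simp only [dist_self, max_lt_iff]
        have := dist_triangle_right x (b x) x₀
        refine ⟨by positivity, by linarith, by positivity⟩)
      rw [hC.const] at h3
      linarith [dist_triangle (C (b x, x, N (b x) - n)) (b x) x₀]
    · set k := n - N (b x)
      have h4 : dist (g (b x) k) (b x) ≤ M (b x) := by
        have h5 := fun m => dist_le_abs_sub_of_step (hgs (b x)) m 0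
        simp only [hg0, Nat.cast_zero, sub_zero, Nat.abs_cast] at h5
        rcases le_total k (M (b x)) with h | h
        · exact (h5 k).trans (by exact_mod_cast h)
        · rw [hgM _ _ h, ← hgM _ _ le_rfl]
          exact h5 _
      linarith [dist_triangle (g (b x) k) (b x) x₀]
  have hPesc : ∀ Q : ℝ, ∃ B : ℝ, ∀ x ∈ A, ((P (b x) : ℝ≥0) : ℝ) ≤ Q → dist x x₀ ≤ B := by
    intro Q
    obtain ⟨B, hB⟩ := hb_esc Q
    refine ⟨B, fun x hx hQ => hB x hx (le_trans ?_ hQ)⟩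
    have h1 := Nat.le_ceil (dist (b x) x₀)
    have h2 : (⌈dist (b x) x₀⌉₊ : ℝ) ≤ P (b x) := by
      exact_mod_cast (show _ ≤ N (b x) + M (b x) + ⌈dist (b x) x₀⌉₊ + 1 by omega)
    rw [NNReal.coe_natCast]
    linarith
  refine ⟨α, fun x => j (b x), hα, hcoarse j fun Q => ?_, fun x => (P (b x) : ℝ≥0),
    hcoarse (fun β => (P β : ℝ≥0)) hPesc, fun z => G (b z.1.1) z.1.1 ⌊z.1.2⌋₊, ⟨?_, ?_⟩, ?_, ?_⟩
  -- A bounded value of `j (b x)` bounds the endpoint of the path from `b x`; since these paths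
  -- escape, this bounds `b x` and hence `x`.
  · obtain ⟨S, hS0, hS⟩ := hα.1 (|Q| + 1) (by positivity)
    obtain ⟨B₁, hB₁⟩ := hgQ (S + dist (α 0) x₀)
    obtain ⟨B₂, hB₂⟩ := hb_esc B₁
    refine ⟨B₂, fun x hx hQ => hB₂ x hx (hB₁ _ (M (b x)) ?_)⟩
    rw [hgM _ _ le_rfl]
    have h1 := hS (j (b x)) 0 (by
      rw [NNReal.dist_eq, NNReal.coe_zero, sub_zero, abs_of_nonneg (NNReal.coe_nonneg _)]
      linarith [le_abs_self Q])
    linarith [dist_triangle (α (j (b x))) (α 0) x₀]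
  · refine isControlled_of_dist_le fun r => ?_
    obtain ⟨B, hB⟩ := hfar r
    obtain ⟨T, hT⟩ := hGbound B
    obtain ⟨S, hS0, hS⟩ := hC.controlled (|r| + 2) (by positivity)
    refine ⟨S + (|r| + 1) + (|T| + |T|), ?_⟩
    rintro ⟨⟨x, t⟩, hxt⟩ ⟨⟨x', t'⟩, hxt'⟩ hd
    rw [Subtype.dist_eq, Prod.dist_eq, max_lt_iff] at hd
    obtain ⟨hd1, hd2⟩ := hd
    simp only at hd1 hd2 ⊢
    have hr := le_abs_self r
    rcases hB x x.2 x' x'.2 hd1 with h | ⟨h1, h2⟩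
    · rw [← h]
      set β := b x
      have hn : |(⌊t⌋₊ : ℝ) - ⌊t'⌋₊| ≤ |r| + 1 := by
        have f1 : (⌊t⌋₊ : ℝ) ≤ t := by exact_mod_cast Nat.floor_le (zero_le (a := t))
        have f2 : (⌊t'⌋₊ : ℝ) ≤ t' := by exact_mod_cast Nat.floor_le (zero_le (a := t'))
        have f3 : (t : ℝ) < ⌊t⌋₊ + 1 := by exact_mod_cast Nat.lt_floor_add_one t
        have f4 : (t' : ℝ) < ⌊t'⌋₊ + 1 := by exact_mod_cast Nat.lt_floor_add_one t'
        rw [NNReal.dist_eq, abs_lt] at hd2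
        rw [abs_le]
        constructor <;> linarith
      have hsub : ∀ m n k : ℕ, |((k - m : ℕ) : ℝ) - (k - n : ℕ)| ≤ |(m : ℝ) - n| ∧
          |((m - k : ℕ) : ℝ) - (n - k : ℕ)| ≤ |(m : ℝ) - n| := by
        intro m n k
        have h1 : |((k - m : ℕ) : ℤ) - (k - n : ℕ)| ≤ |(m : ℤ) - n| := by
          rw [abs_le]
          rcases abs_cases ((m : ℤ) - n) with h | h <;> omega
        have h2 : |((m - k : ℕ) : ℤ) - (n - k : ℕ)| ≤ |(m : ℤ) - n| := by
          rw [abs_le]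
          rcases abs_cases ((m : ℤ) - n) with h | h <;> omega
        exact ⟨by exact_mod_cast h1, by exact_mod_cast h2⟩
      obtain ⟨hs1, hs2⟩ := hsub ⌊t⌋₊ ⌊t'⌋₊ (N β)
      have h3 := hGdist β x x' ⌊t⌋₊ ⌊t'⌋₊
      have h4 := dist_le_abs_sub_of_step (hgs β) (⌊t⌋₊ - N β) (⌊t'⌋₊ - N β)
      have h5 := hS (β, (x : X), N β - ⌊t⌋₊) (β, (x' : X), N β - ⌊t'⌋₊) (by
        rw [Prod.dist_eq, Prod.dist_eq]
        simp only [dist_self, max_lt_iff]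
        refine ⟨by positivity, ?_, ?_⟩
        · rw [Subtype.dist_eq] at hd1
          linarith
        · rw [Nat.dist_eq]
          linarith)
      linarith [abs_nonneg T]
    · have h3 := hT x x.2 h1 ⌊t⌋₊
      have h4 := hT x' x'.2 h2 ⌊t'⌋₊
      linarith [dist_triangle_right (G (b x) x ⌊t⌋₊) (G (b x') x' ⌊t'⌋₊) x₀, le_abs_self T,
        abs_nonneg r]
  · refine isCoarselyProper_of_dist_le x₀ fun Q => ?_
    obtain ⟨B, hB⟩ := hGesc Q
    obtain ⟨T, hT⟩ := hbound (fun β => P β) B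
    refine ⟨max (B + B) |T|, ?_⟩
    rintro ⟨⟨x, t⟩, hxt⟩ ⟨⟨x', t'⟩, hxt'⟩ hz hz'
    have h1 := hB x x.2 _ hz
    have h2 := hB x' x'.2 _ hz'
    rw [Subtype.dist_eq, Prod.dist_eq]
    refine max_le_max ?_ ?_
    · rw [Subtype.dist_eq]
      linarith [dist_triangle_right (x : X) x' x₀]
    · have h3 : (t : ℝ) ≤ T := le_trans (by exact_mod_cast hxt) (hT x x.2 h1)
      have h4 : (t' : ℝ) ≤ T := le_trans (by exact_mod_cast hxt') (hT x' x'.2 h2)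
      simp only [NNReal.dist_eq]
      rw [abs_le]
      constructor <;> linarith [le_abs_self T, t.2, t'.2]
  · intro x
    simp only [Cylinder.bottom, Nat.floor_zero, G, Nat.zero_le, if_true, Nat.sub_zero]
    exact hN _ x x.2 rfl _ le_rfl
  · intro x
    simp only [Cylinder.top, Nat.floor_natCast, Function.comp_apply, G]
    rw [if_neg (by simp only [P]; omega)]
    exact hgM _ _ (by simp only [P]; omega)

end CoarseLS

theorem theorem5p2 {X : Type*} [MetricSpace X] [ProperSpace X]
    (hgeo : CoarseLS.IsGeodesicSpace X)
    (hunb : ¬ Bornology.IsBounded (Set.univ : Set X))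
    (hcomb : CoarseLS.Bicombable X)
    (hconn : CoarseLS.CoarselyPathConnected X) :
    CoarseLS.ccat X ≤ CoarseLS.asdim X := by
  refine le_iInf₂ fun n hn => iInf₂_le n ?_
  obtain ⟨C, hC⟩ := hcomb
  obtain ⟨x₀⟩ : Nonempty X := by
    by_contra h
    rw [not_nonempty_iff] at h
    exact hunb ((Set.toFinite _).isBounded)
  obtain ⟨A, b, hcov, hloc, hfar, hesc⟩ := hn.exists_representatives x₀ hC
  exact ⟨A, fun i => CoarseLS.coarselyCategorical_of_representatives hgeo hunb hconn x₀ hC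
    (hloc i) (hfar i) (hesc i), Set.eq_univ_of_forall fun x => Set.mem_iUnion.2 (hcov x)⟩
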